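/- Let $n\ge 3$ and consider the ferromagnetic Ising model, with no external field and no boundary conditions, on the cycle with vertices $i\in\mathbb Z/n\mathbb Z$ and edges $[i,i+1]$, with coupling constants $J=(J_i)_{i\in\mathbb Z/n\mathbb Z}$, $J_i$ being attached to $[i,i+1]$. Its Gibbs measure on $\{+1,-1\}^{\mathbb Z/n\mathbb Z}$ is $$\pi(\sigma)=Z^{-1}\exp\Big(\sum_{i}J_i\sigma_i\sigma_{i+1}\Big).$$ Write $\sigma^x$ for the configuration obtained from $\sigma$ by flipping the spin at $x$. Heat-bath Glauber dynamics is the Markov chain on configurations with the $2^n\times 2^n$ transition matrix $$A(\sigma,\sigma^x)=\frac1n\,\frac{\pi(\sigma^x)}{\pi(\sigma)+\pi(\sigma^x)},\qquad A(\sigma,\sigma)=1-\sum_x A(\sigma,\sigma^x),$$ all other entries being $0$. Let $\mu_2=\mu_2(J)$ be the second largest eigenvalue of $A$ (eigenvalues counted with multiplicity) and let the relaxation time be $\tau_2(J)=\dfrac{1}{n(1-\mu_2(J))}$. Then $\mu_2(J)<1$ whenever all $J_i\ge 0$, so that $\tau_2(J)$ is well defined, and $\tau_2$ is an increasing function of each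 of the couplings: for every $i$, with the other couplings fixed, (a) if the other couplings are positive, then $\tau_2$ is a strictly increasing function of $J_i\in(0,\infty)$; (b) if the other couplings are non-negative, then $\tau_2$ is a non-decreasing function of $J_i\in[0,\infty)$. -/

import Mathlib

noncomputable section

/-- Spin configurations on a vertex set `V`; the group `ℤˣ` is `{+1, -1}`. -/
abbrev Config (V : Type*) : Type _ := V → ℤˣ

/-- The spin at the vertex `x` as a real number `+1` or `-1`. -/
def spin {V : Type*} (σ : Config V) (x : V) : ℝ := ((σ x : ℤ) : ℝ)

/-- The configuration `σ^x`: flip the spin at `x` and leave all the others unchanged. -/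
def flipAt {V : Type*} [DecidableEq V] (σ : Config V) (x : V) : Config V :=
  Function.update σ x (-σ x)

/-- The probability that one step of the heat-bath dynamics for the measure `π` goes from `σ` to
`σ^x` : choose `x` uniformly in `V`, then flip it with probability `π(σ^x) / (π(σ) + π(σ^x))`. -/
def flipProb {V : Type*} [Fintype V] [DecidableEq V] (π : Config V → ℝ)
    (σ : Config V) (x : V) : ℝ :=
  (1 / (Fintype.card V : ℝ)) * (π (flipAt σ x) / (π σ + π (flipAt σ x)))

/-- The transition matrix of heat-bath Glauber dynamics for the measure `π`. The configurations
`σ` and `σ^x`, `x ∈ V`, are pairwise distinct, so that `A(σ, σ^x)` is `flipProb π σ x`,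
`A(σ, σ)` is `1 - ∑ x, flipProb π σ x`, and all other entries vanish. -/
def glauberMatrix {V : Type*} [Fintype V] [DecidableEq V] (π : Config V → ℝ) :
    Matrix (Config V) (Config V) ℝ :=
  Matrix.of fun σ τ =>
    if τ = σ then 1 - ∑ x, flipProb π σ x
    else ∑ x, if τ = flipAt σ x then flipProb π σ x else 0

/-- The real eigenvalues of a square matrix in decreasing order, repeated according to their
algebraic multiplicity. -/
def eigenvalueList {ι : Type*} [Fintype ι] [DecidableEq ι] (A : Matrix ι ι ℝ) : List ℝ :=
  A.charpoly.roots.sort (· ≥ ·)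

/-- The second largest eigenvalue, with multiplicity (the list is indexed from `0`). -/
def secondEigenvalue {ι : Type*} [Fintype ι] [DecidableEq ι] (A : Matrix ι ι ℝ) : ℝ :=
  (eigenvalueList A).getD 1 0

/-- The unnormalised Gibbs weight of the Ising model on the cycle with vertex set `ZMod n` and
edges `[i, i + 1]`, where the edge `[i, i + 1]` has the coupling constant `J i`. -/
def isingWeight {n : ℕ} [NeZero n] (J : ZMod n → ℝ) (σ : Config (ZMod n)) : ℝ :=
  Real.exp (∑ i, J i * spin σ i * spin σ (i + 1))

/-- The Gibbs measure of the Ising model on the cycle. -/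
def gibbs {n : ℕ} [NeZero n] (J : ZMod n → ℝ) (σ : Config (ZMod n)) : ℝ :=
  isingWeight J σ / ∑ τ, isingWeight J τ

/-- The second largest eigenvalue `μ₂` of heat-bath Glauber dynamics for the Ising model on the
cycle with the couplings `J`. -/
def isingMu2 {n : ℕ} [NeZero n] (J : ZMod n → ℝ) : ℝ :=
  secondEigenvalue (glauberMatrix (gibbs J))

/-- The relaxation time `τ₂ = 1 / (n (1 - μ₂))`. -/
def relaxationTime {n : ℕ} [NeZero n] (J : ZMod n → ℝ) : ℝ :=
  1 / ((n : ℝ) * (1 - isingMu2 J))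

end

/-!
The conditional mean of `σ_x` given the other spins, `tanh (J_{x-1} σ_{x-1} + J_x σ_{x+1})`, is odd
in two signs and therefore *linear* in them. So the dynamics preserves the `n`-dimensional space of
linear functions `∑ v_x σ_x`, on which, with `t_i = tanh J_i`, everything is explicit:

* the covariances `E[σ_x σ_y]` are `(α + β) / (1 + αβ)`, with `α`, `β` the products of `t` along the
  two arcs from `x` to `y` (`gibbs_sum_spin_mul_spin`; both sides solve the same linear recursion,
  which has a maximum principle);
* the Dirichlet form is diagonal, `∑ v_x² d_x` up to normalisation, with `d_x` the mean conditional
  variance of `σ_x` (`cycleCorr_sub_neighbours`).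

The spectral gap is governed by linear functions:

  `n (1 - μ₂) = min over v ≥ 0, v ≠ 0, of (∑ v_x² d_x) / Var (∑ v_x σ_x)`.

That the left side is at most each quotient is the Rayleigh principle (`gap_mul_varForm_le`).
Conversely, let `f` be a nonconstant eigenfunction for `μ`, and let `v_x` be the largest variation of
`f` under a flip at `x`. A contraction estimate gives `μ v ≤ M v`, with `M` the nonnegative matrix of
the dynamics on linear functions (`exists_variation_le`). The covariance matrix `Σ` has nonnegative
entries and `Σ (1 - M)` is diagonal, so pairing with the vector `Σ v ≥ 0` turns this into the
reverse inequality for this `v` (`exists_energyForm_le`). In particular such a `μ` is `< 1`, so the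
constants span the eigenspace of `1`, and `μ₂` is the largest of these `μ` (`isingMu2_spec`).

Finally, each covariance is non-decreasing and each `d_x` is non-increasing in the couplings
(`cycleCorr_mono`, `condVar_anti`), and every `d_x` decreases strictly when the product of all `t_i`
increases strictly. Hence every quotient with `v ≥ 0` decreases, and `τ₂`, the maximum of the inverse
quotients, increases.
-/

/-! ### The second eigenvalue of a reversible matrix -/

/-- The second entry of the sorted list of eigenvalues of a symmetric matrix with simple dominant
eigenvector `ψ` (of eigenvalue `1`): it is attained off the line of `ψ`, and it bounds the Rayleigh
quotient on the orthogonal complement of `ψ`. -/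
theorem secondEigenvalue_of_isHermitian {ι : Type*} [Fintype ι] [DecidableEq ι]
    {S : Matrix ι ι ℝ} (hS : S.IsHermitian) (hcard : 1 < Fintype.card ι) {ψ : ι → ℝ}
    (hψ0 : ψ ≠ 0) (hψ : S.mulVec ψ = ψ)
    (hgap : ∀ (μ : ℝ) (g : ι → ℝ), S.mulVec g = μ • g → (¬ ∃ c : ℝ, g = c • ψ) → μ < 1) :
    (∃ g : ι → ℝ, S.mulVec g = secondEigenvalue S • g ∧ ¬ ∃ c : ℝ, g = c • ψ) ∧
      ∀ g : ι → ℝ, ψ ⬝ᵥ g = 0 → g ⬝ᵥ S.mulVec g ≤ secondEigenvalue S * (g ⬝ᵥ g) := by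
  set b := hS.eigenvectorBasis with hb
  set q := (Fintype.equivOfCardEq (Fintype.card_fin (Fintype.card ι)) : Fin _ ≃ ι) with hq
  have hlam (i : ι) : hS.eigenvalues i = hS.eigenvalues₀ (q.symm i) := rfl
  set e₀ : Fin (Fintype.card ι) := ⟨0, by omega⟩ with he₀
  set e₁ : Fin (Fintype.card ι) := ⟨1, hcard⟩ with he₁
  have hsec : secondEigenvalue S = hS.eigenvalues (q e₁) := by
    have h := hS.sort_roots_charpoly_eq_eigenvalues₀
    simp only [RCLike.re_to_real, Multiset.map_id'] at h
    rw [secondEigenvalue, eigenvalueList, h, hlam, Equiv.symm_apply_apply]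
    simp [he₁, hcard]
  have hvec (i : ι) : S.mulVec (b i) = hS.eigenvalues i • (b i : ι → ℝ) :=
    hS.mulVec_eigenvectorBasis i
  have hparseval (g h : ι → ℝ) :
      ∑ i, ((b i : ι → ℝ) ⬝ᵥ g) * ((b i : ι → ℝ) ⬝ᵥ h) = g ⬝ᵥ h := by
    have := b.sum_inner_mul_inner (WithLp.toLp 2 g) (WithLp.toLp 2 h)
    simpa [EuclideanSpace.inner_eq_star_dotProduct, dotProduct_comm] using this
  have hcoeff (i : ι) (g : ι → ℝ) :
      (b i : ι → ℝ) ⬝ᵥ S.mulVec g = hS.eigenvalues i * ((b i : ι → ℝ) ⬝ᵥ g) := by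
    have hT : S.transpose = S := by simpa [Matrix.IsHermitian] using hS
    rw [Matrix.dotProduct_mulVec, ← Matrix.mulVec_transpose, hT, hvec, smul_dotProduct, smul_eq_mul]
  have hnorm (i : ι) : (b i : ι → ℝ) ⬝ᵥ (b i : ι → ℝ) = 1 := by
    have := orthonormal_iff_ite.1 b.orthonormal i i
    rwa [EuclideanSpace.inner_eq_star_dotProduct, star_trivial, if_pos rfl] at this
  have horth (i j : ι) (h : i ≠ j) : (b i : ι → ℝ) ⬝ᵥ (b j : ι → ℝ) = 0 := by
    have := orthonormal_iff_ite.1 b.orthonormal j i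
    rwa [EuclideanSpace.inner_eq_star_dotProduct, star_trivial, if_neg h.symm] at this
  have htop : ∃ c : ℝ, (b (q e₀) : ι → ℝ) = c • ψ := by
    by_contra hne
    have hlt := hgap _ _ (hvec (q e₀)) hne
    have hzero (i : ι) : (b i : ι → ℝ) ⬝ᵥ ψ = 0 := by
      have h1 := hcoeff i ψ
      rw [hψ] at h1
      have h2 : hS.eigenvalues i ≤ hS.eigenvalues (q e₀) := by
        rw [hlam, hlam, Equiv.symm_apply_apply]
        exact hS.eigenvalues₀_antitone (Fin.mk_le_of_le_val (Nat.zero_le _))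
      have h3 : (1 - hS.eigenvalues i) * ((b i : ι → ℝ) ⬝ᵥ ψ) = 0 := by linarith
      rcases mul_eq_zero.1 h3 with h | h
      · linarith
      · exact h
    have := hparseval ψ ψ
    simp only [hzero, mul_zero, Finset.sum_const_zero] at this
    exact hψ0 (dotProduct_self_eq_zero.1 this.symm)
  obtain ⟨c, hc⟩ := htop
  have hc0 : c ≠ 0 := by
    rintro rfl
    have := hnorm (q e₀)
    rw [hc] at this
    simp at this
  rw [hsec]
  refine ⟨⟨b (q e₁), hvec _, ?_⟩, fun g hg => ?_⟩
  · rintro ⟨d, hd⟩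
    have h0 := horth (q e₀) (q e₁) (by simp [he₀, he₁])
    have h1 := hnorm (q e₁)
    rw [hc, hd] at h0
    rw [hd] at h1
    simp only [smul_dotProduct, dotProduct_smul, smul_eq_mul, mul_eq_zero, hc0, false_or] at h0
    rcases h0 with h | h <;> simp [h] at h1
  · rw [← hparseval, ← hparseval g g, Finset.mul_sum]
    refine Finset.sum_le_sum fun i _ => ?_
    rw [hcoeff]
    by_cases hi : i = q e₀
    · have : (b i : ι → ℝ) ⬝ᵥ g = 0 := by rw [hi, hc, smul_dotProduct, hg, smul_zero]
      simp [this]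
    · have h2 : hS.eigenvalues i ≤ hS.eigenvalues (q e₁) := by
        rw [hlam, hlam, Equiv.symm_apply_apply]
        refine hS.eigenvalues₀_antitone (Fin.mk_le_of_le_val ?_)
        have : q.symm i ≠ e₀ := fun h => hi (by rw [← h, Equiv.apply_symm_apply])
        rw [Ne, Fin.ext_iff] at this
        exact Nat.one_le_iff_ne_zero.2 this
      nlinarith [mul_le_mul_of_nonneg_right h2 (mul_self_nonneg ((b i : ι → ℝ) ⬝ᵥ g))]

/-- The spectral characterization of the second eigenvalue of a matrix `A` that fixes the constants
and is in detailed balance with a positive weight `w`, when `1` is a simple top eigenvalue. It is the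
symmetric case applied to `D A D⁻¹`, `D` the diagonal matrix with entries `√(w i)`. -/
theorem secondEigenvalue_of_detailedBalance {ι : Type*} [Fintype ι] [DecidableEq ι]
    {A : Matrix ι ι ℝ} {w : ι → ℝ} (hw : ∀ i, 0 < w i) (hcard : 1 < Fintype.card ι)
    (hrev : ∀ i j, w i * A i j = w j * A j i) (hone : A.mulVec 1 = 1)
    (hgap : ∀ (μ : ℝ) (f : ι → ℝ), A.mulVec f = μ • f → (¬ ∃ c : ℝ, f = fun _ => c) → μ < 1) :
    (∃ f : ι → ℝ, A.mulVec f = secondEigenvalue A • f ∧ ¬ ∃ c : ℝ, f = fun _ => c) ∧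
      ∀ f : ι → ℝ, ∑ i, w i * f i = 0 →
        ∑ i, w i * (f i * A.mulVec f i) ≤ secondEigenvalue A * ∑ i, w i * (f i * f i) := by
  set r : ι → ℝ := fun i => √(w i) with hr
  have hr0 (i : ι) : r i ≠ 0 := (Real.sqrt_pos.2 (hw i)).ne'
  have hrr (i : ι) : r i * r i = w i := Real.mul_self_sqrt (hw i).le
  set S : Matrix ι ι ℝ := Matrix.diagonal r * A * Matrix.diagonal (fun i => (r i)⁻¹) with hSdef
  have hSapp (i j : ι) : S i j = r i * A i j * (r j)⁻¹ := by
    rw [hSdef, Matrix.mul_diagonal, Matrix.diagonal_mul]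
  have hS : S.IsHermitian := by
    refine Matrix.IsHermitian.ext fun i j => ?_
    rw [star_trivial, hSapp, hSapp]
    have h := hrev i j
    rw [← hrr, ← hrr] at h
    field_simp [hr0 i, hr0 j]
    linear_combination -h
  have hsec : secondEigenvalue S = secondEigenvalue A := by
    have : S.charpoly = A.charpoly := by
      rw [hSdef, Matrix.charpoly_mul_comm, ← mul_assoc, Matrix.diagonal_mul_diagonal]
      simp [hr0]
    rw [secondEigenvalue, secondEigenvalue, eigenvalueList, eigenvalueList, this]
  have hmul (f : ι → ℝ) (i : ι) : S.mulVec (fun j => r j * f j) i = r i * A.mulVec f i := by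
    simp only [Matrix.mulVec, dotProduct, hSapp, Finset.mul_sum]
    refine Finset.sum_congr rfl fun j _ => ?_
    field_simp [hr0 j]
  have hlift (g : ι → ℝ) : g = fun j => r j * ((r j)⁻¹ * g j) := by
    ext j
    rw [mul_inv_cancel_left₀ (hr0 j)]
  have heig (μ : ℝ) (f : ι → ℝ) (h : S.mulVec (fun j => r j * f j) = μ • fun j => r j * f j) :
      A.mulVec f = μ • f := by
    ext i
    have := congrFun h i
    rw [hmul, Pi.smul_apply, smul_eq_mul] at this
    rw [Pi.smul_apply, smul_eq_mul]
    exact mul_left_cancel₀ (hr0 i) (by linear_combination this)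
  have hconst (f : ι → ℝ) (h : ¬ ∃ c : ℝ, (fun j => r j * f j) = c • r) :
      ¬ ∃ c : ℝ, f = fun _ => c := by
    rintro ⟨c, rfl⟩
    exact h ⟨c, by ext j; simp [mul_comm]⟩
  have hne : Nonempty ι := Fintype.card_pos_iff.1 (by omega)
  obtain ⟨⟨g, hg, hgne⟩, hray⟩ := secondEigenvalue_of_isHermitian hS hcard (ψ := r)
    (fun h => hr0 hne.some (congrFun h _))
    (by
      ext i
      have := hmul 1 i
      simpa [hone] using this)
    (fun μ g hg hgne => by
      rw [hlift g] at hg hgne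
      exact hgap μ _ (heig μ _ hg) (hconst _ hgne))
  rw [hsec] at hg hray
  refine ⟨⟨fun j => (r j)⁻¹ * g j, ?_, ?_⟩, fun f hf => ?_⟩
  · rw [hlift g] at hg
    exact heig _ _ hg
  · rw [hlift g] at hgne
    exact hconst _ hgne
  · have h := hray (fun j => r j * f j) (by
      rw [← hf]
      refine Finset.sum_congr rfl fun i _ => ?_
      rw [← hrr]; ring)
    simp only [dotProduct, hmul] at h
    have hsq (u v : ι → ℝ) : ∑ i, w i * (u i * v i) = ∑ i, r i * u i * (r i * v i) :=
      Finset.sum_congr rfl fun i _ => by rw [← hrr]; ring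
    rwa [hsq, hsq]

noncomputable section

/-! ### Two-point function of the cycle -/

/-- The product of `t` along the `k` consecutive edges `[x, x + 1], …, [x + k - 1, x + k]`. -/
def arcProd {n : ℕ} (t : ZMod n → ℝ) (x : ZMod n) (k : ℕ) : ℝ :=
  ∏ j ∈ Finset.range k, t (x + j)

/-- The two-point function `E[σ_x σ_y]` of the Ising model on the cycle with couplings
`J i = artanh (t i)`: the two terms of the numerator are the two arcs joining `x` to `y`. -/
def cycleCorr {n : ℕ} [NeZero n] (t : ZMod n → ℝ) (x y : ZMod n) : ℝ :=
  (arcProd t x (y - x).val + arcProd t y (n - (y - x).val)) / (1 + ∏ i, t i)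

/-- The coefficient of `σ_{x-1}` in the conditional expectation of `σ_x` given the other spins. -/
def leftCoeff {n : ℕ} (t : ZMod n → ℝ) (x : ZMod n) : ℝ :=
  t (x - 1) * (1 - t x ^ 2) / (1 - t (x - 1) ^ 2 * t x ^ 2)

/-- The coefficient of `σ_{x+1}` in the conditional expectation of `σ_x` given the other spins. -/
def rightCoeff {n : ℕ} (t : ZMod n → ℝ) (x : ZMod n) : ℝ :=
  t x * (1 - t (x - 1) ^ 2) / (1 - t (x - 1) ^ 2 * t x ^ 2)

/-- The mean conditional variance `E[Var(σ_x | σ_y, y ≠ x)]`. -/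
def condVar {n : ℕ} [NeZero n] (t : ZMod n → ℝ) (x : ZMod n) : ℝ :=
  (1 - ∏ i, t i) / (1 + ∏ i, t i) *
    ((1 - t (x - 1) ^ 2) * (1 - t x ^ 2) / (1 - t (x - 1) ^ 2 * t x ^ 2))

section

variable {n : ℕ} {t : ZMod n → ℝ}

theorem arcProd_add (t : ZMod n → ℝ) (x : ZMod n) (k m : ℕ) :
    arcProd t x (k + m) = arcProd t x k * arcProd t (x + k) m := by
  simp only [arcProd, Finset.prod_range_add, Nat.cast_add, add_assoc]

theorem arcProd_one (t : ZMod n → ℝ) (x : ZMod n) : arcProd t x 1 = t x := by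
  simp [arcProd]

theorem arcProd_zero (t : ZMod n → ℝ) (x : ZMod n) : arcProd t x 0 = 1 := by
  simp [arcProd]

theorem arcProd_full [NeZero n] (t : ZMod n → ℝ) (x : ZMod n) : arcProd t x n = ∏ i, t i := by
  refine Finset.prod_bij (fun j _ => x + (j : ZMod n)) (fun _ _ => Finset.mem_univ _) ?_ ?_
    (fun _ _ => rfl)
  · intro a ha b hb h
    have h' := (ZMod.natCast_eq_natCast_iff' a b n).1 (add_left_cancel h)
    rwa [Nat.mod_eq_of_lt (Finset.mem_range.1 ha), Nat.mod_eq_of_lt (Finset.mem_range.1 hb)] at h'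
  · intro y _
    exact ⟨(y - x).val, Finset.mem_range.2 (ZMod.val_lt _), by simp⟩

theorem arcProd_nonneg (ht : ∀ i, 0 ≤ t i) (x : ZMod n) (k : ℕ) : 0 ≤ arcProd t x k :=
  Finset.prod_nonneg fun _ _ => ht _

theorem arcProd_le_one (ht : ∀ i, 0 ≤ t i) (ht1 : ∀ i, t i < 1) (x : ZMod n) (k : ℕ) :
    arcProd t x k ≤ 1 :=
  Finset.prod_le_one (fun _ _ => ht _) fun _ _ => (ht1 _).le

theorem arcProd_mono {t' : ZMod n → ℝ} (ht : ∀ i, 0 ≤ t i) (h : t ≤ t') (x : ZMod n) (k : ℕ) :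
    arcProd t x k ≤ arcProd t' x k :=
  Finset.prod_le_prod (fun _ _ => ht _) fun _ _ => h _

theorem prod_coupling_lt_one [NeZero n] (ht : ∀ i, 0 ≤ t i) (ht1 : ∀ i, t i < 1) :
    ∏ i, t i < 1 := by
  rw [← Finset.mul_prod_erase _ _ (Finset.mem_univ (0 : ZMod n))]
  have h1 : ∏ i ∈ Finset.univ.erase (0 : ZMod n), t i ≤ 1 :=
    Finset.prod_le_one (fun _ _ => ht _) fun _ _ => (ht1 _).le
  nlinarith [ht 0, ht1 0]

theorem one_sub_sq_mul_sq_pos (ht : ∀ i, 0 ≤ t i) (ht1 : ∀ i, t i < 1) (i j : ZMod n) :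
    0 < 1 - t i ^ 2 * t j ^ 2 := by
  have h1 : t i ^ 2 < 1 := pow_lt_one₀ (ht i) (ht1 i) two_ne_zero
  have h2 : t j ^ 2 < 1 := pow_lt_one₀ (ht j) (ht1 j) two_ne_zero
  nlinarith [sq_nonneg (t i), sq_nonneg (t j)]

theorem leftCoeff_nonneg (ht : ∀ i, 0 ≤ t i) (ht1 : ∀ i, t i < 1) (x : ZMod n) :
    0 ≤ leftCoeff t x :=
  div_nonneg (mul_nonneg (ht _) (sub_nonneg.2 (pow_le_one₀ (ht _) (ht1 _).le)))
    (one_sub_sq_mul_sq_pos ht ht1 _ _).le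

theorem rightCoeff_nonneg (ht : ∀ i, 0 ≤ t i) (ht1 : ∀ i, t i < 1) (x : ZMod n) :
    0 ≤ rightCoeff t x :=
  div_nonneg (mul_nonneg (ht _) (sub_nonneg.2 (pow_le_one₀ (ht _) (ht1 _).le)))
    (one_sub_sq_mul_sq_pos ht ht1 _ _).le

theorem leftCoeff_add_rightCoeff_lt_one (ht : ∀ i, 0 ≤ t i) (ht1 : ∀ i, t i < 1) (x : ZMod n) :
    leftCoeff t x + rightCoeff t x < 1 := by
  rw [leftCoeff, rightCoeff, ← add_div, div_lt_one (one_sub_sq_mul_sq_pos ht ht1 _ _)]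
  have h1 := ht (x - 1)
  have h2 := ht x
  have h3 := ht1 (x - 1)
  have h4 := ht1 x
  -- the difference of the two sides is `(1 - uv)(1 - u)(1 - v)`
  have huv : 0 < 1 - t (x - 1) * t x := by nlinarith
  nlinarith [mul_pos huv (mul_pos (sub_pos.2 h3) (sub_pos.2 h4))]

theorem condVar_pos [NeZero n] (ht : ∀ i, 0 ≤ t i) (ht1 : ∀ i, t i < 1) (x : ZMod n) :
    0 < condVar t x := by
  have h (i) : 0 < 1 - t i ^ 2 := sub_pos.2 (pow_lt_one₀ (ht i) (ht1 i) two_ne_zero)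
  have hP : 0 ≤ ∏ i, t i := Finset.prod_nonneg fun _ _ => ht _
  exact mul_pos (div_pos (sub_pos.2 (prod_coupling_lt_one ht ht1)) (by linarith))
    (div_pos (mul_pos (h _) (h _)) (one_sub_sq_mul_sq_pos ht ht1 _ _))

theorem cycleCorr_add [NeZero n] (t : ZMod n → ℝ) (x : ZMod n) {k : ℕ} (hk : k ≤ n) :
    cycleCorr t x (x + k) = (arcProd t x k + arcProd t (x + k) (n - k)) / (1 + ∏ i, t i) := by
  rw [cycleCorr, add_sub_cancel_left]
  rcases hk.lt_or_eq with hk | rfl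
  · rw [ZMod.val_cast_of_lt hk]
  · simp [arcProd_full, arcProd_zero, add_comm]

theorem cycleCorr_nonneg [NeZero n] (ht : ∀ i, 0 ≤ t i) (x y : ZMod n) : 0 ≤ cycleCorr t x y :=
  div_nonneg (add_nonneg (arcProd_nonneg ht _ _) (arcProd_nonneg ht _ _))
    (add_nonneg zero_le_one (Finset.prod_nonneg fun _ _ => ht _))

theorem cycleCorr_self [NeZero n] (ht : ∀ i, 0 ≤ t i) (x : ZMod n) : cycleCorr t x x = 1 := by
  have hP : 0 ≤ ∏ i, t i := Finset.prod_nonneg fun _ _ => ht _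
  rw [cycleCorr, sub_self, ZMod.val_zero, arcProd_zero, Nat.sub_zero, arcProd_full,
    div_self (by positivity)]

/-- `x ↦ E[σ_z σ_x]` solves `g x = a_x g (x-1) + b_x g (x+1)` away from `z`, and its defect at `z`
is the mean conditional variance. In matrix form, `Σ (1 - M)` is diagonal. -/
theorem cycleCorr_sub_neighbours [NeZero n] (hn : 2 ≤ n) (ht : ∀ i, 0 ≤ t i) (ht1 : ∀ i, t i < 1)
    (z x : ZMod n) :
    cycleCorr t z x - leftCoeff t x * cycleCorr t z (x - 1) -
      rightCoeff t x * cycleCorr t z (x + 1) = if x = z then condVar t x else 0 := by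
  have hP : 0 ≤ ∏ i, t i := Finset.prod_nonneg fun _ _ => ht _
  have hP1 : 1 + ∏ i, t i ≠ 0 := by positivity
  have hd := (one_sub_sq_mul_sq_pos ht ht1 (x - 1) x).ne'
  split_ifs with h
  · subst h
    obtain ⟨m, rfl⟩ : ∃ m, n = m + 2 := ⟨n - 2, by omega⟩
    have e1 := cycleCorr_add t x (k := 1) (by omega)
    have e2 := cycleCorr_add t x (k := m + 1) (by omega)
    have hc : x + ((m + 1 : ℕ) : ZMod (m + 2)) = x - 1 := by
      have : ((m + 2 : ℕ) : ZMod (m + 2)) = 0 := ZMod.natCast_self _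
      push_cast at this ⊢
      linear_combination this
    have hc' : x + 1 + (m : ZMod (m + 2)) = x - 1 := by rw [← hc]; push_cast; ring
    rw [hc, show m + 2 - (m + 1) = 1 by omega, arcProd_one, add_comm m 1, arcProd_add,
      arcProd_one, Nat.cast_one] at e2
    rw [Nat.cast_one, show m + 2 - 1 = m + 1 by omega, arcProd_one, arcProd_add, arcProd_one,
      hc'] at e1
    have hfull : ∏ i, t i = t x * (arcProd t (x + 1) m * t (x - 1)) := by
      rw [← arcProd_full t x]
      refine (congrArg (arcProd t x) (show m + 2 = 1 + (m + 1) by omega)).trans ?_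
      rw [arcProd_add, arcProd_one, arcProd_add, arcProd_one, Nat.cast_one, hc']
    rw [cycleCorr_self ht, e1, e2, leftCoeff, rightCoeff, condVar]
    generalize ∏ i, t i = P at *
    generalize t (x - 1) = u at *
    generalize t x = v at *
    generalize arcProd t (x + 1) m = w at *
    field_simp
    linear_combination (2 - u ^ 2 - v ^ 2) * hfull
  · obtain ⟨k, hk0, hkn, rfl⟩ : ∃ k : ℕ, 0 < k ∧ k < n ∧ x = z + k := by
      refine ⟨(x - z).val, ?_, ZMod.val_lt _, by simp⟩
      rw [Nat.pos_iff_ne_zero, Ne, ZMod.val_eq_zero, sub_eq_zero]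
      exact h
    obtain ⟨j, rfl⟩ : ∃ j, k = j + 1 := ⟨k - 1, by omega⟩
    obtain ⟨m, hm⟩ : ∃ m, n = j + 1 + 1 + m := ⟨n - (j + 1 + 1), by omega⟩
    have e0 := cycleCorr_add t z (k := j) (by omega)
    have e1 := cycleCorr_add t z (k := j + 1) (by omega)
    have e2 := cycleCorr_add t z (k := j + 1 + 1) (by omega)
    have hc0 : z + ((j + 1 : ℕ) : ZMod n) - 1 = z + j := by push_cast; ring
    have hc1 : z + ((j + 1 : ℕ) : ZMod n) + 1 = z + ((j + 1 + 1 : ℕ) : ZMod n) := by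
      push_cast; ring
    have hc2 : z + (j : ZMod n) + 1 = z + ((j + 1 : ℕ) : ZMod n) := by push_cast; ring
    rw [show n - j = 1 + (1 + m) by omega, arcProd_add, arcProd_add, arcProd_one, Nat.cast_one,
      hc2, arcProd_one, hc1] at e0
    rw [show n - (j + 1) = 1 + m by omega, arcProd_add, arcProd_add _ _ 1 m, arcProd_one,
      arcProd_one, Nat.cast_one, hc1] at e1
    rw [show n - (j + 1 + 1) = m by omega, arcProd_add, arcProd_add, arcProd_one, arcProd_one]
      at e2
    rw [hc0, hc1, e0, e1, e2, leftCoeff, rightCoeff, hc0]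
    rw [hc0] at hd
    field_simp
    ring

/-! ### Monotonicity in the couplings -/

/-- With `α`, `β` the products along the two arcs, the two-point function is `(α + β) / (1 + αβ)`,
which is non-decreasing in `α, β ∈ [0, 1]`. -/
theorem cycleCorr_mono [NeZero n] {t' : ZMod n → ℝ} (ht : ∀ i, 0 ≤ t i) (h : t ≤ t')
    (ht1 : ∀ i, t' i < 1) (x y : ZMod n) : cycleCorr t x y ≤ cycleCorr t' x y := by
  have ht' (i) : 0 ≤ t' i := (ht i).trans (h i)
  have key (s : ZMod n → ℝ) :
      ∏ i, s i = arcProd s x (y - x).val * arcProd s y (n - (y - x).val) := by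
    have := arcProd_add s x (y - x).val (n - (y - x).val)
    rw [Nat.add_sub_cancel' (ZMod.val_lt _).le, arcProd_full] at this
    simpa using this
  rw [cycleCorr, cycleCorr, key t, key t']
  have a0 := arcProd_nonneg ht x (y - x).val
  have b0 := arcProd_nonneg ht y (n - (y - x).val)
  have a1 := arcProd_mono ht h x (y - x).val
  have b1 := arcProd_mono ht h y (n - (y - x).val)
  have a2 := arcProd_le_one ht' ht1 x (y - x).val
  have b2 := arcProd_le_one ht' ht1 y (n - (y - x).val)
  generalize arcProd t x (y - x).val = a at *
  generalize arcProd t y (n - (y - x).val) = b at *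
  generalize arcProd t' x (y - x).val = a' at *
  generalize arcProd t' y (n - (y - x).val) = b' at *
  have a0' : 0 ≤ a' := a0.trans a1
  have b0' : 0 ≤ b' := b0.trans b1
  refine (div_le_div_iff₀ (by positivity) (by positivity)).2 ?_
  -- the difference of the cross products splits into the two one-variable increments
  have h1 : 0 ≤ (a' - a) * (1 - b * b') :=
    mul_nonneg (by linarith) (by nlinarith)
  have h2 : 0 ≤ (b' - b) * (1 - a * a') :=
    mul_nonneg (by linarith) (by nlinarith)
  nlinarith

/-- Each of the factors `(1 - P) / (1 + P)` and `(1 - u²)(1 - v²) / (1 - u²v²)` is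
non-increasing. -/
theorem condVar_anti [NeZero n] {t' : ZMod n → ℝ} (ht : ∀ i, 0 ≤ t i) (h : t ≤ t')
    (ht1 : ∀ i, t' i < 1) (x : ZMod n) :
    condVar t' x ≤ condVar t x ∧ (∏ i, t i < ∏ i, t' i → condVar t' x < condVar t x) := by
  have ht' (i) : 0 ≤ t' i := (ht i).trans (h i)
  have ht1' (i) : t i < 1 := (h i).trans_lt (ht1 i)
  have hP : 0 ≤ ∏ i, t i := Finset.prod_nonneg fun _ _ => ht _
  have hPP : ∏ i, t i ≤ ∏ i, t' i := Finset.prod_le_prod (fun _ _ => ht _) fun _ _ => h _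
  have hP1 : ∏ i, t' i < 1 := prod_coupling_lt_one ht' ht1
  have hq (s : ZMod n → ℝ) (hs : ∀ i, 0 ≤ s i) (hs1 : ∀ i, s i < 1) (i) : 0 < 1 - s i ^ 2 :=
    sub_pos.2 (pow_lt_one₀ (hs i) (hs1 i) two_ne_zero)
  have hd := one_sub_sq_mul_sq_pos ht ht1' (x - 1) x
  have hd' := one_sub_sq_mul_sq_pos ht' ht1 (x - 1) x
  have hlocal : (1 - t' (x - 1) ^ 2) * (1 - t' x ^ 2) / (1 - t' (x - 1) ^ 2 * t' x ^ 2) ≤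
      (1 - t (x - 1) ^ 2) * (1 - t x ^ 2) / (1 - t (x - 1) ^ 2 * t x ^ 2) := by
    have hu := pow_le_pow_left₀ (ht (x - 1)) (h (x - 1)) 2
    have hv := pow_le_pow_left₀ (ht x) (h x) 2
    have hu1 := hq t' ht' ht1 (x - 1)
    have hv1 := hq t' ht' ht1 x
    have hu0 := sq_nonneg (t (x - 1))
    have hv0 := sq_nonneg (t x)
    rw [div_le_div_iff₀ hd' hd]
    generalize t' (x - 1) ^ 2 = u' at *
    generalize t' x ^ 2 = v' at *
    generalize t (x - 1) ^ 2 = u at *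
    generalize t x ^ 2 = v at *
    -- the difference is `(u' - u)(1 - v)(1 - v') + (v' - v)(1 - u)(1 - u')`
    have h1 : 0 ≤ (u' - u) * ((1 - v) * (1 - v')) :=
      mul_nonneg (by linarith) (mul_nonneg (by linarith) (by linarith))
    have h2 : 0 ≤ (v' - v) * ((1 - u) * (1 - u')) :=
      mul_nonneg (by linarith) (mul_nonneg (by linarith) (by linarith))
    nlinarith
  have hpos : 0 < (1 - t' (x - 1) ^ 2) * (1 - t' x ^ 2) / (1 - t' (x - 1) ^ 2 * t' x ^ 2) :=
    div_pos (mul_pos (hq t' ht' ht1 _) (hq t' ht' ht1 _)) hd'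
  have hfrac : (1 - ∏ i, t' i) / (1 + ∏ i, t' i) ≤ (1 - ∏ i, t i) / (1 + ∏ i, t i) :=
    div_le_div₀ (by linarith) (by linarith) (by linarith) (by linarith)
  refine ⟨mul_le_mul hfrac hlocal hpos.le (div_nonneg (by linarith) (by linarith)), fun hlt => ?_⟩
  refine mul_lt_mul ?_ hlocal hpos (div_nonneg (by linarith) (by linarith))
  exact div_lt_div₀ (by linarith) (by linarith) (by linarith) (by linarith)

/-- Maximum principle for the recursion satisfied by the correlations. -/
theorem eq_zero_of_neighbour_recursion [NeZero n] (ht : ∀ i, 0 ≤ t i) (ht1 : ∀ i, t i < 1)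
    {f : ZMod n → ℝ}
    (hf : ∀ x, f x = 0 ∨ f x = leftCoeff t x * f (x - 1) + rightCoeff t x * f (x + 1)) :
    f = 0 := by
  obtain ⟨x, hx⟩ := Finite.exists_max fun x => |f x|
  suffices h : f x = 0 by
    ext y
    have := hx y
    rw [h, abs_zero] at this
    exact abs_nonpos_iff.1 this
  rcases hf x with h | h
  · exact h
  · have h1 : |f x| ≤ (leftCoeff t x + rightCoeff t x) * |f x| := by
      calc |f x| = |leftCoeff t x * f (x - 1) + rightCoeff t x * f (x + 1)| := by rw [← h]
        _ ≤ |leftCoeff t x * f (x - 1)| + |rightCoeff t x * f (x + 1)| := abs_add_le _ _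
        _ = leftCoeff t x * |f (x - 1)| + rightCoeff t x * |f (x + 1)| := by
            rw [abs_mul, abs_mul, abs_of_nonneg (leftCoeff_nonneg ht ht1 x),
              abs_of_nonneg (rightCoeff_nonneg ht ht1 x)]
        _ ≤ _ := by
            rw [add_mul]
            exact add_le_add (mul_le_mul_of_nonneg_left (hx _) (leftCoeff_nonneg ht ht1 x))
              (mul_le_mul_of_nonneg_left (hx _) (rightCoeff_nonneg ht ht1 x))
    have h2 := leftCoeff_add_rightCoeff_lt_one ht ht1 x
    have h3 := abs_nonneg (f x)
    have : |f x| ≤ 0 := by nlinarith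
    exact abs_nonpos_iff.1 this

end

/-! ### Heat-bath dynamics -/

section

variable {V : Type*}

theorem spin_mul_self (σ : Config V) (x : V) : spin σ x * spin σ x = 1 := by
  rcases Int.units_eq_one_or (σ x) with h | h <;> simp [spin, h]

theorem spin_eq_one_or (σ : Config V) (x : V) : spin σ x = 1 ∨ spin σ x = -1 := by
  rcases Int.units_eq_one_or (σ x) with h | h <;> simp [spin, h]

variable [DecidableEq V]

theorem spin_flipAt_self (σ : Config V) (x : V) : spin (flipAt σ x) x = -spin σ x := by
  simp [spin, flipAt]

theorem spin_flipAt_of_ne (σ : Config V) {x y : V} (h : y ≠ x) :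
    spin (flipAt σ x) y = spin σ y := by
  simp [spin, flipAt, h]

theorem flipAt_flipAt (σ : Config V) (x : V) : flipAt (flipAt σ x) x = σ := by
  simp [flipAt]

theorem flipAt_comm (σ : Config V) (x y : V) :
    flipAt (flipAt σ x) y = flipAt (flipAt σ y) x := by
  by_cases h : x = y
  · rw [h]
  · have h1 : (flipAt σ x) y = σ y := by simp [flipAt, Ne.symm h]
    have h2 : (flipAt σ y) x = σ x := by simp [flipAt, h]
    rw [flipAt, h1, flipAt, flipAt, h2, flipAt, Function.update_comm h]

theorem flipAt_ne (σ : Config V) (x : V) : flipAt σ x ≠ σ := by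
  intro h
  have h1 := spin_flipAt_self σ x
  rw [h] at h1
  rcases spin_eq_one_or σ x with h2 | h2 <;> rw [h2] at h1 <;> norm_num at h1

/-- Single flips connect the configuration space. -/
theorem exists_const_of_flipAt_invariant [Fintype V] {f : Config V → ℝ}
    (h : ∀ σ x, f (flipAt σ x) = f σ) : ∃ c : ℝ, f = fun _ => c := by
  refine ⟨f 1, funext fun σ => ?_⟩
  suffices H : ∀ s : Finset V, f (fun x => if x ∈ s then σ x else 1) = f 1 by
    simpa using H Finset.univ
  intro s
  induction s using Finset.induction_on with
  | empty => exact congrArg f (by ext; simp)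
  | insert a s ha ih =>
    rw [← ih]
    set τ : Config V := fun x => if x ∈ s then σ x else 1 with hτ
    have hτ' : (fun x => if x ∈ insert a s then σ x else 1) = Function.update τ a (σ a) := by
      ext x
      by_cases hx : x = a
      · subst hx; simp
      · simp [hx, hτ]
    have hτa : τ a = 1 := by simp [hτ, ha]
    rw [hτ']
    rcases Int.units_eq_one_or (σ a) with h1 | h1
    · rw [h1, ← hτa, Function.update_eq_self]
    · rw [h1, ← hτa]
      exact h τ a

variable [Fintype V]

theorem glauberMatrix_apply (π : Config V → ℝ) (σ τ : Config V) :
    glauberMatrix π σ τ = (if τ = σ then 1 - ∑ x, flipProb π σ x else 0) +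
      ∑ x, if τ = flipAt σ x then flipProb π σ x else 0 := by
  rw [glauberMatrix, Matrix.of_apply]
  split_ifs with h
  · subst h
    simp [(flipAt_ne τ _).symm]
  · rw [zero_add]

theorem glauberMatrix_mulVec (π : Config V → ℝ) (f : Config V → ℝ) (σ : Config V) :
    (glauberMatrix π).mulVec f σ = f σ + ∑ x, flipProb π σ x * (f (flipAt σ x) - f σ) := by
  simp only [Matrix.mulVec, dotProduct, glauberMatrix_apply, add_mul, Finset.sum_add_distrib,
    ite_mul, zero_mul, Finset.sum_ite_eq', Finset.mem_univ, if_true, Finset.sum_mul]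
  rw [Finset.sum_comm]
  simp only [Finset.sum_ite_eq', Finset.mem_univ, if_true, mul_sub, Finset.sum_sub_distrib,
    Finset.sum_mul, sub_mul]
  ring

theorem glauberMatrix_detailedBalance (π : Config V → ℝ) (σ τ : Config V) :
    π σ * glauberMatrix π σ τ = π τ * glauberMatrix π τ σ := by
  rw [glauberMatrix_apply, glauberMatrix_apply, mul_add, mul_add]
  congr 1
  · by_cases h : τ = σ
    · rw [h]
    · rw [if_neg h, if_neg (Ne.symm h), mul_zero, mul_zero]
  · rw [Finset.mul_sum, Finset.mul_sum]
    refine Finset.sum_congr rfl fun x _ => ?_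
    by_cases h : τ = flipAt σ x
    · have h' : σ = flipAt τ x := by rw [h, flipAt_flipAt]
      rw [if_pos h, if_pos h', flipProb, flipProb, ← h, ← h', add_comm (π τ)]
      ring
    · have h' : σ ≠ flipAt τ x := fun h' => h (by rw [h', flipAt_flipAt])
      rw [if_neg h, if_neg h', mul_zero, mul_zero]

end

/-! ### The Ising model on the cycle -/

/-- `tanh` of the couplings, the natural parameters of the high-temperature expansion. -/
def tanhCoupling {n : ℕ} (J : ZMod n → ℝ) (i : ZMod n) : ℝ := Real.tanh (J i)

/-- The conditional mean of `σ_x` given the other spins; on a cycle it is linear in the two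
neighbouring spins. -/
def condMean {n : ℕ} (t : ZMod n → ℝ) (σ : Config (ZMod n)) (x : ZMod n) : ℝ :=
  leftCoeff t x * spin σ (x - 1) + rightCoeff t x * spin σ (x + 1)

section

variable {n : ℕ} {J : ZMod n → ℝ}

theorem tanh_strictMono : StrictMono Real.tanh := by
  intro x y h
  rw [Real.tanh_eq_sinh_div_cosh, Real.tanh_eq_sinh_div_cosh,
    div_lt_div_iff₀ (Real.cosh_pos _) (Real.cosh_pos _)]
  have := Real.sinh_pos_iff.2 (sub_pos.2 h)
  rw [Real.sinh_sub] at this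
  linarith

theorem tanhCoupling_nonneg (hJ : ∀ i, 0 ≤ J i) (i : ZMod n) : 0 ≤ tanhCoupling J i := by
  have := tanh_strictMono.monotone (hJ i)
  rwa [Real.tanh_zero] at this

theorem tanhCoupling_lt_one (J : ZMod n → ℝ) (i : ZMod n) : tanhCoupling J i < 1 :=
  Real.tanh_lt_one _

theorem condMean_flipAt_self (hn : 2 ≤ n) (t : ZMod n → ℝ) (σ : Config (ZMod n)) (x : ZMod n) :
    condMean t (flipAt σ x) x = condMean t σ x := by
  have hfact : Fact (1 < n) := ⟨hn⟩
  rw [condMean, condMean, spin_flipAt_of_ne σ (by simp), spin_flipAt_of_ne σ (by simp)]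

theorem abs_condMean_sub_flipAt {t : ZMod n → ℝ} (ht : ∀ i, 0 ≤ t i)
    (ht1 : ∀ i, t i < 1) (σ : Config (ZMod n)) (x y : ZMod n) :
    |condMean t σ y - condMean t (flipAt σ x) y| ≤
      2 * ((if y = x + 1 then leftCoeff t y else 0) + if y = x - 1 then rightCoeff t y else 0) := by
  have hs (w : ZMod n) : |spin σ w - spin (flipAt σ x) w| ≤ if w = x then 2 else 0 := by
    split_ifs with h
    · subst h
      rw [spin_flipAt_self]
      rcases spin_eq_one_or σ w with h | h <;> rw [h] <;> norm_num
    · rw [spin_flipAt_of_ne σ h, sub_self, abs_zero]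
  have hl := leftCoeff_nonneg ht ht1 y
  have hr := rightCoeff_nonneg ht ht1 y
  have e : condMean t σ y - condMean t (flipAt σ x) y =
      leftCoeff t y * (spin σ (y - 1) - spin (flipAt σ x) (y - 1)) +
        rightCoeff t y * (spin σ (y + 1) - spin (flipAt σ x) (y + 1)) := by
    rw [condMean, condMean]; ring
  have h1 := mul_le_mul_of_nonneg_left (hs (y - 1)) hl
  have h2 := mul_le_mul_of_nonneg_left (hs (y + 1)) hr
  rw [e]
  refine (abs_add_le _ _).trans ?_
  rw [abs_mul, abs_mul, abs_of_nonneg hl, abs_of_nonneg hr]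
  simp only [sub_eq_iff_eq_add, ← eq_sub_iff_add_eq] at h1 h2
  refine (add_le_add h1 h2).trans (le_of_eq ?_)
  split_ifs <;> ring

variable [NeZero n]

theorem isingWeight_pos (J : ZMod n → ℝ) (σ : Config (ZMod n)) : 0 < isingWeight J σ :=
  Real.exp_pos _

theorem partition_pos (J : ZMod n → ℝ) : 0 < ∑ σ, isingWeight J σ :=
  Finset.sum_pos (fun _ _ => isingWeight_pos J _) Finset.univ_nonempty

theorem gibbs_pos (J : ZMod n → ℝ) (σ : Config (ZMod n)) : 0 < gibbs J σ :=
  div_pos (isingWeight_pos J σ) (partition_pos J)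

theorem gibbs_sum (J : ZMod n → ℝ) : ∑ σ, gibbs J σ = 1 := by
  simp only [gibbs, ← Finset.sum_div]
  exact div_self (partition_pos J).ne'

theorem isingWeight_flipAt (hn : 2 ≤ n) (J : ZMod n → ℝ) (σ : Config (ZMod n)) (x : ZMod n) :
    isingWeight J (flipAt σ x) = isingWeight J σ *
      Real.exp (-(2 * (spin σ x * (J (x - 1) * spin σ (x - 1) + J x * spin σ (x + 1))))) := by
  have hfact : Fact (1 < n) := ⟨hn⟩
  rw [isingWeight, isingWeight, ← Real.exp_add]
  congr 1
  have key (i : ZMod n) : J i * spin (flipAt σ x) i * spin (flipAt σ x) (i + 1) =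
      J i * spin σ i * spin σ (i + 1) - (if i = x then 2 * (J x * spin σ x * spin σ (x + 1)) else 0)
        - (if i = x - 1 then 2 * (J (x - 1) * spin σ (x - 1) * spin σ x) else 0) := by
    by_cases h1 : i = x
    · subst h1
      have h2 : i ≠ i - 1 := fun h => one_ne_zero (by linear_combination h : (1 : ZMod n) = 0)
      rw [spin_flipAt_self, spin_flipAt_of_ne σ (by simp), if_pos rfl, if_neg h2]
      ring
    · by_cases h2 : i = x - 1
      · subst h2
        rw [if_neg h1, if_pos rfl, sub_add_cancel, spin_flipAt_self, spin_flipAt_of_ne σ h1]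
        ring
      · have h3 : i + 1 ≠ x := fun h => h2 (by rw [← h, add_sub_cancel_right])
        rw [if_neg h1, if_neg h2, spin_flipAt_of_ne σ h1, spin_flipAt_of_ne σ h3]
        ring
  simp only [key, Finset.sum_sub_distrib, Finset.sum_ite_eq', Finset.mem_univ, if_true]
  ring

theorem tanh_add_eq_div (x y : ℝ) :
    Real.tanh (x + y) = (Real.tanh x + Real.tanh y) / (1 + Real.tanh x * Real.tanh y) := by
  have h1 := (Real.cosh_pos x).ne'
  have h2 := (Real.cosh_pos y).ne'
  simp only [Real.tanh_eq_sinh_div_cosh, Real.sinh_add, Real.cosh_add]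
  have h3 : Real.cosh x * Real.cosh y + Real.sinh x * Real.sinh y ≠ 0 := by
    rw [← Real.cosh_add]; exact (Real.cosh_pos _).ne'
  have h4 : 1 + Real.sinh x / Real.cosh x * (Real.sinh y / Real.cosh y) ≠ 0 := by
    intro h
    apply h3
    field_simp at h
    linarith
  rw [div_eq_div_iff h3 h4]
  field_simp

theorem tanh_mul_sign (x : ℝ) {s : ℝ} (hs : s = 1 ∨ s = -1) :
    Real.tanh (s * x) = s * Real.tanh x := by
  rcases hs with rfl | rfl <;> simp

/-- The function `tanh (p l + q r)` of two signs `l` and `r` is linear in them. -/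
theorem tanh_mul_sign_add (p q : ℝ) {l r : ℝ} (hl : l = 1 ∨ l = -1) (hr : r = 1 ∨ r = -1) :
    Real.tanh (p * l + q * r) =
      Real.tanh p * (1 - Real.tanh q ^ 2) / (1 - Real.tanh p ^ 2 * Real.tanh q ^ 2) * l +
        Real.tanh q * (1 - Real.tanh p ^ 2) / (1 - Real.tanh p ^ 2 * Real.tanh q ^ 2) * r := by
  have hu := Real.tanh_sq_lt_one p
  have hv := Real.tanh_sq_lt_one q
  rw [tanh_add_eq_div, mul_comm p, mul_comm q, tanh_mul_sign _ hl, tanh_mul_sign _ hr]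
  generalize Real.tanh p = u at *
  generalize Real.tanh q = v at *
  have hd : 1 - u ^ 2 * v ^ 2 ≠ 0 := by nlinarith [sq_nonneg u, sq_nonneg v]
  have hl2 : l ^ 2 = 1 := by rcases hl with rfl | rfl <;> norm_num
  have hr2 : r ^ 2 = 1 := by rcases hr with rfl | rfl <;> norm_num
  have hfac : (1 + l * u * (r * v)) * (1 - l * u * (r * v)) = 1 - u ^ 2 * v ^ 2 := by
    linear_combination (-u ^ 2 * v ^ 2 * r ^ 2) * hl2 - u ^ 2 * v ^ 2 * hr2
  have hne : 1 + l * u * (r * v) ≠ 0 := fun h => hd (by rw [← hfac, h, zero_mul])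
  rw [div_eq_iff hne]
  have h1 : l * u + r * v = (u * (1 - v ^ 2) * l + v * (1 - u ^ 2) * r) *
      (1 + l * u * (r * v)) / (1 - u ^ 2 * v ^ 2) := by
    rw [eq_div_iff hd]
    linear_combination (-(u ^ 2 * v * r * (1 - v ^ 2))) * hl2 - u * v ^ 2 * l * (1 - u ^ 2) * hr2
  rw [h1]
  ring

theorem flipProb_gibbs (hn : 2 ≤ n) (J : ZMod n → ℝ) (σ : Config (ZMod n)) (x : ZMod n) :
    flipProb (gibbs J) σ x =
      1 / n * ((1 - spin σ x * condMean (tanhCoupling J) σ x) / 2) := by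
  have hsigmoid (y : ℝ) : Real.exp (-(2 * y)) / (1 + Real.exp (-(2 * y))) =
      (1 - Real.tanh y) / 2 := by
    have e : Real.exp (-(2 * y)) = Real.exp (-y) * Real.exp (-y) := by
      rw [← Real.exp_add]; congr 1; ring
    have e1 : Real.exp y * Real.exp (-y) = 1 := by rw [← Real.exp_add]; simp
    have h1 := Real.exp_pos y
    have h2 := Real.exp_pos (-y)
    rw [Real.tanh_eq, e]
    field_simp
    linear_combination (2 * Real.exp (-y)) * e1
  have hmean : spin σ x * condMean (tanhCoupling J) σ x =
      Real.tanh (spin σ x * (J (x - 1) * spin σ (x - 1) + J x * spin σ (x + 1))) := by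
    rw [tanh_mul_sign _ (spin_eq_one_or σ x),
      tanh_mul_sign_add _ _ (spin_eq_one_or σ _) (spin_eq_one_or σ _)]
    rfl
  rw [hmean, ← hsigmoid, flipProb, ZMod.card, gibbs, gibbs, isingWeight_flipAt hn]
  have h1 := (partition_pos J).ne'
  have h2 := (isingWeight_pos J σ).ne'
  congr 1
  generalize Real.exp (-(2 * (spin σ x * (J (x - 1) * spin σ (x - 1) + J x * spin σ (x + 1))))) = e
  rw [← add_div, div_div_div_cancel_right₀ h1, ← mul_one_add, mul_div_mul_left _ _ h2]

/-- The heat-bath update: `E[σ_x g] = E[m_x g]` when `g` does not depend on `σ_x`. -/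
theorem gibbs_sum_spin_sub_condMean (hn : 2 ≤ n) (J : ZMod n → ℝ) (x : ZMod n)
    {g : Config (ZMod n) → ℝ} (hg : ∀ σ, g (flipAt σ x) = g σ) :
    ∑ σ, gibbs J σ * (g σ * (spin σ x - condMean (tanhCoupling J) σ x)) = 0 := by
  refine Finset.sum_involution (fun σ _ => flipAt σ x) (fun σ _ => ?_)
    (fun σ _ _ => flipAt_ne σ x) (fun _ _ => Finset.mem_univ _) (fun σ _ => flipAt_flipAt σ x)
  have h1 := gibbs_pos J σ
  have h2 := gibbs_pos J (flipAt σ x)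
  have hn0 : (n : ℝ) ≠ 0 := Nat.cast_ne_zero.2 (NeZero.ne n)
  have h := flipProb_gibbs hn J σ x
  rw [flipProb, ZMod.card] at h
  replace h := mul_left_cancel₀ (one_div_ne_zero hn0) h
  rw [div_eq_iff (by positivity)] at h
  rw [hg, condMean_flipAt_self hn, spin_flipAt_self]
  have hs := spin_mul_self σ x
  generalize spin σ x = s at *
  generalize condMean (tanhCoupling J) σ x = m at *
  linear_combination (-2 * s * g σ) * h + ((gibbs J σ + gibbs J (flipAt σ x)) * m * g σ) * hs

end

section

variable {n : ℕ} [NeZero n] {J : ZMod n → ℝ}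

theorem gibbs_sum_mul_condMean (J t : ZMod n → ℝ) (g : Config (ZMod n) → ℝ) (x : ZMod n) :
    ∑ σ, gibbs J σ * (g σ * (spin σ x - condMean t σ x)) =
      ∑ σ, gibbs J σ * (g σ * spin σ x) -
        leftCoeff t x * ∑ σ, gibbs J σ * (g σ * spin σ (x - 1)) -
        rightCoeff t x * ∑ σ, gibbs J σ * (g σ * spin σ (x + 1)) := by
  rw [Finset.mul_sum, Finset.mul_sum, ← Finset.sum_sub_distrib, ← Finset.sum_sub_distrib]
  refine Finset.sum_congr rfl fun σ _ => ?_
  rw [condMean]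
  ring

theorem gibbs_sum_spin (hn : 2 ≤ n) (hJ : ∀ i, 0 ≤ J i) (x : ZMod n) :
    ∑ σ, gibbs J σ * spin σ x = 0 := by
  suffices h : (fun x => ∑ σ, gibbs J σ * spin σ x) = 0 from congrFun h x
  refine eq_zero_of_neighbour_recursion (tanhCoupling_nonneg hJ) (tanhCoupling_lt_one J)
    fun x => Or.inr ?_
  have h := gibbs_sum_spin_sub_condMean hn J x (g := fun _ => 1) fun _ => rfl
  rw [gibbs_sum_mul_condMean] at h
  simp only [one_mul] at h
  linarith

/-- The explicit formula for the two-point function: both sides solve the recursion imposed by the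
heat-bath update, and they agree at `x = z`. -/
theorem gibbs_sum_spin_mul_spin (hn : 2 ≤ n) (hJ : ∀ i, 0 ≤ J i) (z x : ZMod n) :
    ∑ σ, gibbs J σ * (spin σ z * spin σ x) = cycleCorr (tanhCoupling J) z x := by
  have ht := tanhCoupling_nonneg hJ
  have ht1 := tanhCoupling_lt_one J
  suffices h : (fun x => ∑ σ, gibbs J σ * (spin σ z * spin σ x) -
      cycleCorr (tanhCoupling J) z x) = 0 from sub_eq_zero.1 (congrFun h x)
  refine eq_zero_of_neighbour_recursion ht ht1 fun x => ?_
  by_cases hx : x = z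
  · left
    subst hx
    simp only [spin_mul_self, mul_one, gibbs_sum, cycleCorr_self ht, sub_self]
  · right
    have h := gibbs_sum_spin_sub_condMean hn J x (g := fun σ => spin σ z) fun σ =>
      spin_flipAt_of_ne σ (Ne.symm hx)
    rw [gibbs_sum_mul_condMean] at h
    have h' := cycleCorr_sub_neighbours hn ht ht1 z x
    rw [if_neg hx] at h'
    linarith

/-! ### The relaxation time as a maximum of explicit quotients -/

/-- The variance of `∑ x, v x * σ_x`. -/
def varForm (t v : ZMod n → ℝ) : ℝ := ∑ x, v x * ∑ z, v z * cycleCorr t z x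

/-- The Dirichlet form of `∑ x, v x * σ_x`, normalised so that each vertex has rate `1`. -/
def energyForm (t v : ZMod n → ℝ) : ℝ := ∑ x, v x ^ 2 * condVar t x

theorem varForm_mono {t t' v : ZMod n → ℝ} (ht : ∀ i, 0 ≤ t i) (h : t ≤ t')
    (ht1 : ∀ i, t' i < 1) (hv : 0 ≤ v) : varForm t v ≤ varForm t' v :=
  Finset.sum_le_sum fun x _ => mul_le_mul_of_nonneg_left
    (Finset.sum_le_sum fun z _ => mul_le_mul_of_nonneg_left (cycleCorr_mono ht h ht1 z x) (hv z))
    (hv x)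

theorem varForm_pos {t v : ZMod n → ℝ} (ht : ∀ i, 0 ≤ t i) (hv : 0 ≤ v) (hv0 : v ≠ 0) :
    0 < varForm t v := by
  obtain ⟨y, hy⟩ := Function.ne_iff.1 hv0
  have hy : 0 < v y := lt_of_le_of_ne (hv y) (Ne.symm hy)
  have hterm (x z : ZMod n) : 0 ≤ v z * cycleCorr t z x :=
    mul_nonneg (hv z) (cycleCorr_nonneg ht z x)
  refine Finset.sum_pos' (fun x _ => mul_nonneg (hv x) (Finset.sum_nonneg fun z _ => hterm x z))
    ⟨y, Finset.mem_univ _, mul_pos hy (Finset.sum_pos' (fun z _ => hterm y z)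
      ⟨y, Finset.mem_univ _, ?_⟩)⟩
  rw [cycleCorr_self ht, mul_one]
  exact hy

theorem energyForm_pos {t v : ZMod n → ℝ} (ht : ∀ i, 0 ≤ t i) (ht1 : ∀ i, t i < 1) (hv0 : v ≠ 0) :
    0 < energyForm t v := by
  obtain ⟨y, hy⟩ := Function.ne_iff.1 hv0
  exact Finset.sum_pos' (fun x _ => mul_nonneg (sq_nonneg _) (condVar_pos ht ht1 x).le)
    ⟨y, Finset.mem_univ _, mul_pos (sq_pos_of_ne_zero hy) (condVar_pos ht ht1 y)⟩

theorem energyForm_anti {t t' v : ZMod n → ℝ} (ht : ∀ i, 0 ≤ t i) (h : t ≤ t')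
    (ht1 : ∀ i, t' i < 1) : energyForm t' v ≤ energyForm t v :=
  Finset.sum_le_sum fun x _ =>
    mul_le_mul_of_nonneg_left (condVar_anti ht h ht1 x).1 (sq_nonneg _)

theorem energyForm_strictAnti {t t' v : ZMod n → ℝ} (ht : ∀ i, 0 ≤ t i) (h : t ≤ t')
    (ht1 : ∀ i, t' i < 1) (hP : ∏ i, t i < ∏ i, t' i) (hv0 : v ≠ 0) :
    energyForm t' v < energyForm t v := by
  obtain ⟨y, hy⟩ := Function.ne_iff.1 hv0
  exact Finset.sum_lt_sum
    (fun x _ => mul_le_mul_of_nonneg_left (condVar_anti ht h ht1 x).1 (sq_nonneg _))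
    ⟨y, Finset.mem_univ _, mul_lt_mul_of_pos_left ((condVar_anti ht h ht1 y).2 hP)
      (sq_pos_of_ne_zero hy)⟩

/-- `⟨v, Σ (1 - M) v⟩` is the Dirichlet form, where `Σ` is the covariance matrix and `M` the
dynamics on linear functions. -/
theorem sum_cov_mul_sub_neighbours (hn : 2 ≤ n) {t : ZMod n → ℝ} (ht : ∀ i, 0 ≤ t i)
    (ht1 : ∀ i, t i < 1) (v : ZMod n → ℝ) :
    ∑ x, v x * ∑ z, v z * (cycleCorr t z x - leftCoeff t x * cycleCorr t z (x - 1) -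
      rightCoeff t x * cycleCorr t z (x + 1)) = energyForm t v := by
  simp only [cycleCorr_sub_neighbours hn ht ht1, mul_ite, mul_zero, Finset.sum_ite_eq,
    Finset.mem_univ, if_true, energyForm]
  exact Finset.sum_congr rfl fun x _ => by ring

theorem glauber_mulVec (hn : 2 ≤ n) (J : ZMod n → ℝ) (f : Config (ZMod n) → ℝ)
    (σ : Config (ZMod n)) :
    n * (glauberMatrix (gibbs J)).mulVec f σ = ∑ x, (f σ +
      (1 - spin σ x * condMean (tanhCoupling J) σ x) / 2 * (f (flipAt σ x) - f σ)) := by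
  have hn0 : (n : ℝ) ≠ 0 := Nat.cast_ne_zero.2 (NeZero.ne n)
  rw [glauberMatrix_mulVec, Finset.sum_add_distrib, Finset.sum_const, Finset.card_univ, ZMod.card,
    nsmul_eq_mul, mul_add, Finset.mul_sum]
  congr 1
  refine Finset.sum_congr rfl fun x _ => ?_
  rw [flipProb_gibbs hn]
  field_simp

/-- The contraction estimate. If `f` is an eigenfunction and `v x` is the largest variation of `f`
under a flip at `x`, then `μ v ≤ M v` for the nonnegative matrix `M` describing the dynamics on
linear functions; here this is stated as `(1 - M) v ≤ (1 - μ) v`, multiplied by `n`. -/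
theorem exists_variation_le (hn : 2 ≤ n) (hJ : ∀ i, 0 ≤ J i) {μ : ℝ} {f : Config (ZMod n) → ℝ}
    (hf : (glauberMatrix (gibbs J)).mulVec f = μ • f) (hne : ¬ ∃ c : ℝ, f = fun _ => c) :
    ∃ v : ZMod n → ℝ, 0 ≤ v ∧ v ≠ 0 ∧ ∀ x,
      v x - leftCoeff (tanhCoupling J) (x + 1) * v (x + 1) -
        rightCoeff (tanhCoupling J) (x - 1) * v (x - 1) ≤ n * (1 - μ) * v x := by
  set t := tanhCoupling J with ht_def
  have ht : ∀ i, 0 ≤ t i := tanhCoupling_nonneg hJ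
  have ht1 : ∀ i, t i < 1 := tanhCoupling_lt_one J
  choose s hs using fun x : ZMod n => Finite.exists_max fun σ => |f σ - f (flipAt σ x)|
  set v : ZMod n → ℝ := fun x => |f (s x) - f (flipAt (s x) x)| with hv
  have hv0 : 0 ≤ v := fun x => abs_nonneg _
  refine ⟨v, hv0, fun h => hne (exists_const_of_flipAt_invariant fun σ x => ?_), fun x => ?_⟩
  · have h1 := (hs x σ).trans_eq (congrFun h x)
    exact (sub_eq_zero.1 (abs_nonpos_iff.1 h1)).symm
  · set σ := s x with hσ
    -- the update at `y` of `f`, and the total influence of `x` on `y`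
    set K : ZMod n → Config (ZMod n) → ℝ := fun y σ =>
      f σ + (1 - spin σ y * condMean t σ y) / 2 * (f (flipAt σ y) - f σ) with hK
    set c : ZMod n → ℝ := fun y =>
      (if y = x + 1 then leftCoeff t y else 0) + if y = x - 1 then rightCoeff t y else 0 with hc
    have hstep (y : ZMod n) :
        |K y σ - K y (flipAt σ x)| ≤ (v x + c y * v y) - if y = x then v x else 0 := by
      have hc0 : 0 ≤ c y := by
        have := leftCoeff_nonneg ht ht1 y
        have := rightCoeff_nonneg ht ht1 y
        simp only [hc]
        split_ifs <;> linarith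
      by_cases hy : y = x
      · subst hy
        have e : K y σ - K y (flipAt σ y) = 0 := by
          simp only [hK, flipAt_flipAt, spin_flipAt_self, condMean_flipAt_self hn]
          ring
        rw [e, abs_zero, if_pos rfl]
        have := mul_nonneg hc0 (hv0 y)
        linarith
      · rw [if_neg hy, sub_zero]
        set q := (1 - spin σ y * condMean t (flipAt σ x) y) / 2 with hq
        have e : K y σ - K y (flipAt σ x) = (1 - q) * (f σ - f (flipAt σ x)) +
            q * (f (flipAt σ y) - f (flipAt (flipAt σ y) x)) +
            spin σ y * (condMean t σ y - condMean t (flipAt σ x) y) / 2 *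
              (f σ - f (flipAt σ y)) := by
          simp only [hK, hq, spin_flipAt_of_ne σ hy, flipAt_comm σ x y]
          ring
        have hmean : |condMean t (flipAt σ x) y| ≤ 1 := by
          have hl := leftCoeff_nonneg ht ht1 y
          have hr := rightCoeff_nonneg ht ht1 y
          have hlr := leftCoeff_add_rightCoeff_lt_one ht ht1 y
          rw [abs_le, condMean]
          rcases spin_eq_one_or (flipAt σ x) (y - 1) with h | h <;>
            rcases spin_eq_one_or (flipAt σ x) (y + 1) with h' | h' <;>
            rw [h, h'] <;> constructor <;> linarith
        have hspin : |spin σ y| = 1 := by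
          rcases spin_eq_one_or σ y with h | h <;> rw [h] <;> norm_num
        have hq01 : 0 ≤ q ∧ q ≤ 1 := by
          have h1 : |spin σ y * condMean t (flipAt σ x) y| ≤ 1 := by
            rwa [abs_mul, hspin, one_mul]
          obtain ⟨h2, h3⟩ := abs_le.1 h1
          constructor <;> rw [hq] <;> linarith
        rw [e]
        refine (abs_add_three _ _ _).trans ?_
        have b1 : |(1 - q) * (f σ - f (flipAt σ x))| ≤ (1 - q) * v x := by
          rw [abs_mul, abs_of_nonneg (by linarith : 0 ≤ 1 - q)]
        have b2 : |q * (f (flipAt σ y) - f (flipAt (flipAt σ y) x))| ≤ q * v x := by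
          rw [abs_mul, abs_of_nonneg hq01.1]
          exact mul_le_mul_of_nonneg_left (hs x _) hq01.1
        have b3 : |spin σ y * (condMean t σ y - condMean t (flipAt σ x) y) / 2 *
            (f σ - f (flipAt σ y))| ≤ c y * v y := by
          rw [abs_mul, abs_div, abs_mul, hspin, one_mul, abs_two]
          refine mul_le_mul ?_ (hs y σ) (abs_nonneg _) hc0
          have := abs_condMean_sub_flipAt ht ht1 σ x y
          simp only [hc]
          linarith
        linarith
    have hA (τ : Config (ZMod n)) : n * (μ * f τ) = ∑ y, K y τ := by
      rw [← glauber_mulVec hn, hf, Pi.smul_apply, smul_eq_mul]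
    have hsum : n * (|μ| * v x) ≤ ∑ y, ((v x + c y * v y) - if y = x then v x else 0) := by
      calc n * (|μ| * v x) = |n * (μ * f σ) - n * (μ * f (flipAt σ x))| := by
            rw [← mul_sub, ← mul_sub, abs_mul, abs_mul, Nat.abs_cast]
        _ = |∑ y, (K y σ - K y (flipAt σ x))| := by rw [hA, hA, Finset.sum_sub_distrib]
        _ ≤ ∑ y, |K y σ - K y (flipAt σ x)| := Finset.abs_sum_le_sum_abs _ _
        _ ≤ _ := Finset.sum_le_sum fun y _ => hstep y
    have hsum' : ∑ y, ((v x + c y * v y) - if y = x then v x else 0) =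
        n * v x + (leftCoeff t (x + 1) * v (x + 1) + rightCoeff t (x - 1) * v (x - 1)) - v x := by
      simp only [hc, add_mul, ite_mul, zero_mul, Finset.sum_sub_distrib, Finset.sum_add_distrib,
        Finset.sum_ite_eq', Finset.mem_univ, if_true, Finset.sum_const, Finset.card_univ,
        ZMod.card, nsmul_eq_mul]
    rw [hsum'] at hsum
    have h1 : n * (μ * v x) ≤ n * (|μ| * v x) :=
      mul_le_mul_of_nonneg_left (mul_le_mul_of_nonneg_right (le_abs_self μ) (hv0 x))
        (Nat.cast_nonneg n)
    linarith

/-- If `μ` has a nonconstant eigenfunction, then `n (1 - μ)` is at least the quotient of energy and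
variance of some linear function with nonnegative coefficients: pair the contraction
estimate with the nonnegative vector `Σ v`. -/
theorem exists_energyForm_le (hn : 2 ≤ n) (hJ : ∀ i, 0 ≤ J i) {μ : ℝ} {f : Config (ZMod n) → ℝ}
    (hf : (glauberMatrix (gibbs J)).mulVec f = μ • f) (hne : ¬ ∃ c : ℝ, f = fun _ => c) :
    ∃ v : ZMod n → ℝ, 0 ≤ v ∧ v ≠ 0 ∧
      energyForm (tanhCoupling J) v ≤ n * (1 - μ) * varForm (tanhCoupling J) v := by
  obtain ⟨v, hv, hv0, hle⟩ := exists_variation_le hn hJ hf hne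
  refine ⟨v, hv, hv0, ?_⟩
  have ht := tanhCoupling_nonneg hJ
  have ht1 := tanhCoupling_lt_one J
  generalize tanhCoupling J = t at *
  set w : ZMod n → ℝ := fun x => ∑ z, v z * cycleCorr t z x with hw
  have hw0 (x : ZMod n) : 0 ≤ w x :=
    Finset.sum_nonneg fun z _ => mul_nonneg (hv z) (cycleCorr_nonneg ht z x)
  have hright : n * (1 - μ) * varForm t v = ∑ x, w x * (n * (1 - μ) * v x) := by
    rw [varForm, Finset.mul_sum]
    exact Finset.sum_congr rfl fun x _ => by simp only [hw]; ring
  have hleft : energyForm t v = ∑ x, w x * (v x - leftCoeff t (x + 1) * v (x + 1) -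
      rightCoeff t (x - 1) * v (x - 1)) := by
    have h1 : ∑ x, w x * (leftCoeff t (x + 1) * v (x + 1)) =
        ∑ x, w (x - 1) * (leftCoeff t x * v x) :=
      Fintype.sum_equiv (Equiv.addRight 1) _ _ fun x => by simp
    have h2 : ∑ x, w x * (rightCoeff t (x - 1) * v (x - 1)) =
        ∑ x, w (x + 1) * (rightCoeff t x * v x) :=
      Fintype.sum_equiv (Equiv.subRight 1) _ _ fun x => by simp
    simp only [mul_sub, Finset.sum_sub_distrib]
    rw [h1, h2, ← Finset.sum_sub_distrib, ← Finset.sum_sub_distrib,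
      ← sum_cov_mul_sub_neighbours hn ht ht1]
    refine Finset.sum_congr rfl fun x _ => ?_
    have h3 : ∑ z, v z * (cycleCorr t z x - leftCoeff t x * cycleCorr t z (x - 1) -
        rightCoeff t x * cycleCorr t z (x + 1)) =
        w x - leftCoeff t x * w (x - 1) - rightCoeff t x * w (x + 1) := by
      simp only [hw, Finset.mul_sum]
      rw [← Finset.sum_sub_distrib, ← Finset.sum_sub_distrib]
      exact Finset.sum_congr rfl fun z _ => by ring
    rw [h3]
    ring
  rw [hleft, hright]
  exact Finset.sum_le_sum fun x _ => mul_le_mul_of_nonneg_left (hle x) (hw0 x)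

theorem eigenvalue_lt_one (hn : 2 ≤ n) (hJ : ∀ i, 0 ≤ J i) {μ : ℝ} {f : Config (ZMod n) → ℝ}
    (hf : (glauberMatrix (gibbs J)).mulVec f = μ • f) (hne : ¬ ∃ c : ℝ, f = fun _ => c) :
    μ < 1 := by
  obtain ⟨v, hv, hv0, h⟩ := exists_energyForm_le hn hJ hf hne
  have h1 := energyForm_pos (tanhCoupling_nonneg hJ) (tanhCoupling_lt_one J) hv0
  have h2 := varForm_pos (tanhCoupling_nonneg hJ) hv hv0
  have h3 := pos_of_mul_pos_left (h1.trans_le h) h2.le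
  have h4 := pos_of_mul_pos_right h3 (Nat.cast_nonneg n)
  linarith

theorem isingMu2_spec (hn : 2 ≤ n) (hJ : ∀ i, 0 ≤ J i) :
    (∃ f : Config (ZMod n) → ℝ, (glauberMatrix (gibbs J)).mulVec f = isingMu2 J • f ∧
        ¬ ∃ c : ℝ, f = fun _ => c) ∧
      ∀ f : Config (ZMod n) → ℝ, ∑ σ, gibbs J σ * f σ = 0 →
        ∑ σ, gibbs J σ * (f σ * (glauberMatrix (gibbs J)).mulVec f σ) ≤
          isingMu2 J * ∑ σ, gibbs J σ * (f σ * f σ) := by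
  refine secondEigenvalue_of_detailedBalance (gibbs_pos J) ?_
    (glauberMatrix_detailedBalance (gibbs J)) ?_ fun μ f hf hne => eigenvalue_lt_one hn hJ hf hne
  · exact Fintype.one_lt_card_iff.2 ⟨flipAt 1 0, 1, flipAt_ne _ _⟩
  · ext σ
    rw [glauberMatrix_mulVec]
    simp

theorem isingMu2_lt_one (hn : 2 ≤ n) (hJ : ∀ i, 0 ≤ J i) : isingMu2 J < 1 := by
  obtain ⟨⟨f, hf, hne⟩, -⟩ := isingMu2_spec hn hJ
  exact eigenvalue_lt_one hn hJ hf hne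

theorem gibbs_sum_linear_sq (hn : 2 ≤ n) (hJ : ∀ i, 0 ≤ J i) (v : ZMod n → ℝ) :
    ∑ σ, gibbs J σ * ((∑ x, v x * spin σ x) * ∑ x, v x * spin σ x) =
      varForm (tanhCoupling J) v := by
  simp only [varForm, ← gibbs_sum_spin_mul_spin hn hJ, Finset.mul_sum, Finset.sum_mul]
  rw [Finset.sum_comm]
  refine Finset.sum_congr rfl fun x _ => ?_
  rw [Finset.sum_comm]
  exact Finset.sum_congr rfl fun z _ => Finset.sum_congr rfl fun σ _ => by ring

theorem glauber_mulVec_linear (hn : 2 ≤ n) (J v : ZMod n → ℝ) (σ : Config (ZMod n)) :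
    n * (glauberMatrix (gibbs J)).mulVec (fun σ => ∑ x, v x * spin σ x) σ =
      n * ∑ x, v x * spin σ x - ∑ x, v x * (spin σ x - condMean (tanhCoupling J) σ x) := by
  have hdiff (x : ZMod n) :
      (∑ y, v y * spin (flipAt σ x) y) - ∑ y, v y * spin σ y = -2 * (v x * spin σ x) := by
    rw [← Finset.sum_sub_distrib, Finset.sum_eq_single x]
    · rw [spin_flipAt_self]; ring
    · intro y _ hy
      rw [spin_flipAt_of_ne σ hy, sub_self]
    · simp
  rw [glauber_mulVec hn]
  simp only [hdiff]
  rw [Finset.sum_add_distrib, Finset.sum_const, Finset.card_univ, ZMod.card, nsmul_eq_mul,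
    sub_eq_add_neg, ← Finset.sum_neg_distrib]
  congr 1
  refine Finset.sum_congr rfl fun x _ => ?_
  linear_combination v x * condMean (tanhCoupling J) σ x * spin_mul_self σ x

/-- The Rayleigh principle on the space of linear functions. -/
theorem gap_mul_varForm_le (hn : 2 ≤ n) (hJ : ∀ i, 0 ≤ J i) (v : ZMod n → ℝ) :
    n * (1 - isingMu2 J) * varForm (tanhCoupling J) v ≤ energyForm (tanhCoupling J) v := by
  have ht := tanhCoupling_nonneg hJ
  have ht1 := tanhCoupling_lt_one J
  have hmean : ∑ σ, gibbs J σ * ∑ x, v x * spin σ x = 0 := by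
    simp only [Finset.mul_sum]
    rw [Finset.sum_comm]
    refine Finset.sum_eq_zero fun x _ => ?_
    rw [← mul_zero (v x), ← gibbs_sum_spin hn hJ x, Finset.mul_sum]
    exact Finset.sum_congr rfl fun σ _ => by ring
  have h := (isingMu2_spec hn hJ).2 (fun σ => ∑ x, v x * spin σ x) hmean
  have henergy : ∑ σ, gibbs J σ * ((∑ x, v x * spin σ x) *
      ∑ x, v x * (spin σ x - condMean (tanhCoupling J) σ x)) = energyForm (tanhCoupling J) v := by
    have e (z x : ZMod n) : ∑ σ, gibbs J σ * (spin σ z *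
        (spin σ x - condMean (tanhCoupling J) σ x)) = cycleCorr (tanhCoupling J) z x -
        leftCoeff (tanhCoupling J) x * cycleCorr (tanhCoupling J) z (x - 1) -
        rightCoeff (tanhCoupling J) x * cycleCorr (tanhCoupling J) z (x + 1) := by
      rw [gibbs_sum_mul_condMean]
      simp only [gibbs_sum_spin_mul_spin hn hJ]
    rw [← sum_cov_mul_sub_neighbours hn ht ht1]
    simp only [← e, Finset.mul_sum, Finset.sum_mul]
    rw [Finset.sum_comm]
    refine Finset.sum_congr rfl fun x _ => ?_
    rw [Finset.sum_comm]
    exact Finset.sum_congr rfl fun z _ => Finset.sum_congr rfl fun σ _ => by ring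
  have hA : n * ∑ σ, gibbs J σ * ((∑ x, v x * spin σ x) *
      (glauberMatrix (gibbs J)).mulVec (fun σ => ∑ x, v x * spin σ x) σ) =
      n * varForm (tanhCoupling J) v - energyForm (tanhCoupling J) v := by
    rw [← henergy, ← gibbs_sum_linear_sq hn hJ, Finset.mul_sum, Finset.mul_sum,
      ← Finset.sum_sub_distrib]
    refine Finset.sum_congr rfl fun σ _ => ?_
    linear_combination gibbs J σ * (∑ x, v x * spin σ x) * glauber_mulVec_linear hn J v σ
  rw [gibbs_sum_linear_sq hn hJ] at h
  have h' := mul_le_mul_of_nonneg_left h (Nat.cast_nonneg n : (0 : ℝ) ≤ n)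
  rw [hA] at h'
  linarith

theorem gap_pos (hn : 2 ≤ n) (hJ : ∀ i, 0 ≤ J i) : 0 < n * (1 - isingMu2 J) :=
  mul_pos (Nat.cast_pos.2 (by omega)) (sub_pos.2 (isingMu2_lt_one hn hJ))

/-- The vector `v` that bounds the gap for the couplings `J` is a test vector for `J'`; raising the
couplings raises its variance and lowers its energy. -/
theorem relaxationTime_mono (hn : 2 ≤ n) {J' : ZMod n → ℝ} (hJ : ∀ i, 0 ≤ J i) (h : J ≤ J') :
    relaxationTime J ≤ relaxationTime J' ∧
      (∏ i, tanhCoupling J i < ∏ i, tanhCoupling J' i → relaxationTime J < relaxationTime J') := by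
  have hJ' (i) : 0 ≤ J' i := (hJ i).trans (h i)
  have ht := tanhCoupling_nonneg hJ
  have ht1 := tanhCoupling_lt_one J'
  have htt : tanhCoupling J ≤ tanhCoupling J' := fun i => tanh_strictMono.monotone (h i)
  obtain ⟨⟨f, hf, hne⟩, -⟩ := isingMu2_spec hn hJ
  obtain ⟨v, hv, hv0, hle⟩ := exists_energyForm_le hn hJ hf hne
  have hle' := gap_mul_varForm_le hn hJ' v
  have hg := gap_pos hn hJ
  have hg' := gap_pos hn hJ'
  have hvar := mul_le_mul_of_nonneg_left (varForm_mono ht htt ht1 hv) hg.le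
  have hpos := varForm_pos (tanhCoupling_nonneg hJ') hv hv0
  refine ⟨one_div_le_one_div_of_le hg' ?_, fun hP => one_div_lt_one_div_of_lt hg' ?_⟩
  · have := energyForm_anti (v := v) ht htt ht1
    exact le_of_mul_le_mul_right (by linarith) hpos
  · have := energyForm_strictAnti ht htt ht1 hP hv0
    exact lt_of_mul_lt_mul_right (by linarith) hpos.le

end

end

theorem theorem1 (n : ℕ) [NeZero n] (hn : 3 ≤ n) :
    (∀ J : ZMod n → ℝ, (∀ i, 0 ≤ J i) → isingMu2 J < 1) ∧
    (∀ J : ZMod n → ℝ, (∀ i, 0 < J i) → ∀ i : ZMod n,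
      StrictMonoOn (fun t : ℝ => relaxationTime (Function.update J i t)) (Set.Ioi 0)) ∧
    (∀ J : ZMod n → ℝ, (∀ i, 0 ≤ J i) → ∀ i : ZMod n,
      MonotoneOn (fun t : ℝ => relaxationTime (Function.update J i t)) (Set.Ici 0)) := by
  have hn2 : 2 ≤ n := by omega
  have hnonneg {J : ZMod n → ℝ} (hJ : ∀ i, 0 ≤ J i) (i : ZMod n) {s : ℝ} (hs : 0 ≤ s) :
      ∀ j, 0 ≤ Function.update J i s j := by
    intro j
    rw [Function.update_apply]
    split_ifs
    exacts [hs, hJ j]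
  have hupd (J : ZMod n → ℝ) (i : ZMod n) {s s' : ℝ} (h : s ≤ s') :
      Function.update J i s ≤ Function.update J i s' := update_le_update_iff'.2 h
  refine ⟨fun J hJ => isingMu2_lt_one hn2 hJ, fun J hJ i s hs s' _ hss => ?_,
    fun J hJ i s hs s' _ hss => ?_⟩
  · refine (relaxationTime_mono hn2 (hnonneg (fun j => (hJ j).le) i (Set.mem_Ioi.1 hs).le)
      (hupd J i hss.le)).2 ?_
    refine Finset.prod_lt_prod (fun j _ => ?_) (fun j _ => ?_) ⟨i, Finset.mem_univ _, ?_⟩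
    · have h0 : 0 < Function.update J i s j := by
        rw [Function.update_apply]
        split_ifs
        exacts [hs, hJ j]
      have := tanh_strictMono h0
      rwa [Real.tanh_zero] at this
    · exact tanh_strictMono.monotone (hupd J i hss.le j)
    · simpa [tanhCoupling] using tanh_strictMono hss
  · exact (relaxationTime_mono hn2 (hnonneg hJ i hs) (hupd J i hss)).1
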